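/- Let $D$ be an integral domain of Krull dimension $1$ with field of fractions $K$, and let $\Theta:=\{D_M\mid M\in\mathrm{Max}(D)\}$ be the family of its localizations at maximal ideals, regarded as subrings of $K$. Then the Jaffard degree of $\Theta$ equals the Cantor–Bendixson rank of $\mathrm{Max}(D)^{\mathrm{inv}}$. The terms are as follows. For a domain $A$ with field of fractions $K$, a set $\Lambda$ of rings $T$ with $A\subseteq T\subseteq K$ is a *Jaffard family of $A$* if: (1) $K\notin\Lambda$ or $\Lambda=\{K\}$; (2) every $T\in\Lambda$ is flat over $A$; (3) $I=\bigcap_{T\in\Lambda}IT$ for every ideal $I$ of $A$; (4) for all $S\neq T$ in $\Lambda$, the only prime ideal of $A$ that is both the contraction of a prime ideal of $S$ and the contraction of a prime ideal of $T$ is $(0)$; (5) every nonzero $x\in K$ is a nonunit of only finitely many $T\in\Lambda$ (that is, $x\in T$ and $x$ is not a unit of $T$). A ring $T$ is a *Jaffard overring of $A$* if it belongs to some Jaffard family of $A$. Define for every ordinal $\alpha$ a family $\Theta_\alpha\subseteq\Theta$ and a ring $T_\alpha$ by transfinite recursion: $\Theta_0:=\Theta$ and $T_0:=D$; $\Theta_{\alpha+1}:=\Theta_\alpha\setminus\{T\mid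 T\text{ is a Jaffard overring of }T_\alpha\}$; $\Theta_\alpha:=\bigcap_{\beta<\alpha}\Theta_\beta$ if $\alpha$ is a limit ordinal; and, for $\alpha>0$, $T_\alpha:=\bigcap_{S\in\Theta_\alpha}S$, with $T_\alpha:=K$ if $\Theta_\alpha=\emptyset$. The *Jaffard degree* of $\Theta$ is the least ordinal $\alpha$ such that $T_\alpha=T_\beta$ for all $\beta>\alpha$. $\mathrm{Max}(D)^{\mathrm{inv}}$ is the set of maximal ideals of $D$ with the topology induced by the inverse topology on $\mathrm{Spec}(D)$, i.e. the topology generated by the sets $V(I)=\{P\mid I\subseteq P\}$ with $I$ a finitely generated ideal. The *Cantor–Bendixson rank* of a topological space $X$ is the least ordinal $\alpha$ with $\mathcal L^\alpha(X)=\mathcal L^{\alpha+1}(X)$, where $\mathcal L^0(X)=X$, $\mathcal L^{\alpha+1}(X)$ is the set of non-isolated points of the subspace $\mathcal L^\alpha(X)$, and $\mathcal L^\alpha(X)=\bigcap_{\beta<\alpha}\mathcal L^\beta(X)$ for limit ordinals $\alpha$. -/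

import Mathlib

universe u

namespace JaffardDegree

section Families

variable {K : Type u} [Field K]

/-- For an overring `T` of `A`, the set of primes `Q ∩ A`, with `Q` a prime ideal of `T`. -/
def sigma {A T : Subring K} (h : A ≤ T) : Set (PrimeSpectrum A) :=
  Set.range (PrimeSpectrum.comap (Subring.inclusion h))

/-- The extension `I T`, as a `T`-submodule of the field `K`. -/
def extend {A : Subring K} (I : Ideal A) (T : Subring K) : Submodule T K :=
  Submodule.span T ((fun a : A => (a : K)) '' (I : Set A))

/-- `Θ` is a Jaffard family of `A`; here `A` is a subring of `K` and the members of `Θ` are rings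
between `A` and `K`. (The notion is meant for `K` the field of fractions of `A`.) -/
structure IsJaffardFamily (A : Subring K) (Θ : Set (Subring K)) : Prop where
  overring : ∀ T ∈ Θ, A ≤ T
  top_mem : ⊤ ∉ Θ ∨ Θ = {⊤}
  flat : ∀ T (hT : T ∈ Θ), (Subring.inclusion (overring T hT)).Flat
  complete : ∀ I : Ideal A,
    ((fun a : A => (a : K)) '' (I : Set A)) = ⋂ T ∈ Θ, (extend I T : Set K)
  independent : ∀ S (hS : S ∈ Θ) T (hT : T ∈ Θ), S ≠ T →
    sigma (overring S hS) ∩ sigma (overring T hT) = {⊥}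
  locallyFinite : ∀ x : K, x ≠ 0 →
    {T ∈ Θ | ∃ hx : x ∈ T, ¬ IsUnit (⟨x, hx⟩ : T)}.Finite

/-- `T` is a Jaffard overring of `A`. -/
def IsJaffardOverring (A T : Subring K) : Prop :=
  ∃ Θ : Set (Subring K), IsJaffardFamily A Θ ∧ T ∈ Θ

/-- The pair `(T_α, Θ_α)`, starting from the ring `A` and the family `Θ`. The infimum of the empty
family of subrings of `K` is `⊤`, that is, `K` itself. -/
noncomputable def derivedPair (A : Subring K) (Θ : Set (Subring K)) (α : Ordinal.{u}) :
    Subring K × Set (Subring K) :=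
  Ordinal.limitRecOn α (A, Θ)
    (fun _ p => (sInf (p.2 \ {T | IsJaffardOverring p.1 T}), p.2 \ {T | IsJaffardOverring p.1 T}))
    (fun α _ p => (sInf (⋂ (β) (h : β < α), (p β h).2), ⋂ (β) (h : β < α), (p β h).2))

/-- The ring `T_α` of the derived sequence of the family `Θ` of overrings of `A`. -/
noncomputable def derivedRing (A : Subring K) (Θ : Set (Subring K)) (α : Ordinal.{u}) :
    Subring K :=
  (derivedPair A Θ α).1

/-- The subfamily `Θ_α` of the family `Θ` of overrings of `A`. -/
noncomputable def derivedFamily (A : Subring K) (Θ : Set (Subring K)) (α : Ordinal.{u}) :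
    Set (Subring K) :=
  (derivedPair A Θ α).2

/-- The Jaffard degree: the least `α` such that `T_α = T_β` for all `β > α`. -/
noncomputable def jaffardDegree (A : Subring K) (Θ : Set (Subring K)) : Ordinal.{u} :=
  sInf {α | ∀ β > α, derivedRing A Θ α = derivedRing A Θ β}

theorem derivedRing_zero (A : Subring K) (Θ : Set (Subring K)) : derivedRing A Θ 0 = A := by
  simp [derivedRing, derivedPair]

theorem derivedFamily_zero (A : Subring K) (Θ : Set (Subring K)) : derivedFamily A Θ 0 = Θ := by
  simp [derivedFamily, derivedPair]

theorem derivedFamily_add_one (A : Subring K) (Θ : Set (Subring K)) (α : Ordinal.{u}) :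
    derivedFamily A Θ (α + 1) =
      derivedFamily A Θ α \ {T | IsJaffardOverring (derivedRing A Θ α) T} := by
  simp [derivedFamily, derivedRing, derivedPair]

theorem derivedFamily_limit (A : Subring K) (Θ : Set (Subring K)) {α : Ordinal.{u}}
    (hα : Order.IsSuccLimit α) :
    derivedFamily A Θ α = ⋂ β < α, derivedFamily A Θ β := by
  simp only [derivedFamily, derivedPair]
  rw [Ordinal.limitRecOn_limit _ _ _ _ hα]

theorem derivedRing_eq_sInf (A : Subring K) (Θ : Set (Subring K)) {α : Ordinal.{u}}
    (hα : α ≠ 0) : derivedRing A Θ α = sInf (derivedFamily A Θ α) := by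
  induction α using Ordinal.limitRecOn with
  | zero => exact absurd rfl hα
  | add_one α _ => simp [derivedFamily, derivedRing, derivedPair]
  | limit α h _ =>
    simp only [derivedFamily, derivedRing, derivedPair]
    rw [Ordinal.limitRecOn_limit _ _ _ _ h]

theorem derivedFamily_antitone (A : Subring K) (Θ : Set (Subring K)) :
    Antitone (derivedFamily A Θ) := by
  intro α β h
  induction β using Ordinal.limitRecOn with
  | zero => rw [nonpos_iff_eq_zero.mp h]
  | add_one β ih =>
    rcases h.eq_or_lt with rfl | h
    · exact le_rfl
    · rw [derivedFamily_add_one]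
      exact Set.sdiff_subset.trans (ih (Order.lt_add_one_iff.mp h))
  | limit β hβ _ =>
    rcases h.eq_or_lt with rfl | h
    · exact le_rfl
    · rw [derivedFamily_limit A Θ hβ]
      exact Set.biInter_subset_of_mem (t := fun γ => derivedFamily A Θ γ) h

/-- The Jaffard degree is a genuine minimum: the derived sequence always stabilizes. -/
theorem jaffardDegree_isLeast (A : Subring K) (Θ : Set (Subring K)) :
    IsLeast {α | ∀ β > α, derivedRing A Θ α = derivedRing A Θ β} (jaffardDegree A Θ) := by
  have key : ∀ T : Subring K, ∃ γ : Ordinal.{u}, ∀ δ,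
      T ∈ derivedFamily A Θ γ → T ∈ derivedFamily A Θ δ := by
    intro T
    by_cases h : ∃ γ, T ∉ derivedFamily A Θ γ
    · obtain ⟨γ, hγ⟩ := h
      exact ⟨γ, fun _ h => absurd h hγ⟩
    · push Not at h
      exact ⟨0, fun δ _ => h δ⟩
  choose γ hγ using key
  refine ⟨csInf_mem ⟨(⨆ T, γ T) + 1, fun β hβ => ?_⟩, fun α hα => csInf_le' hα⟩
  have hle : ∀ T, γ T ≤ (⨆ T, γ T) + 1 := fun T =>
    (le_ciSup (Ordinal.bddAbove_of_small (s := Set.range γ)) T).trans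
      (Order.lt_add_one_iff.mpr le_rfl).le
  have hpos : (0 : Ordinal.{u}) < (⨆ T, γ T) + 1 := Order.lt_add_one_iff.mpr zero_le
  rw [derivedRing_eq_sInf A Θ hpos.ne', derivedRing_eq_sInf A Θ (hpos.trans hβ).ne']
  congr 1
  exact Set.Subset.antisymm
    (fun T hT => hγ T β (derivedFamily_antitone A Θ (hle T) hT))
    (derivedFamily_antitone A Θ (le_of_lt hβ))

end Families

/-- The Cantor–Bendixson rank of a topological space `X`: the least `α` such that the `α`-th and
the `(α + 1)`-st Cantor–Bendixson derivatives of `X` coincide. -/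
noncomputable def cantorBendixsonRank (X : Type u) [TopologicalSpace X] : Ordinal.{u} :=
  sInf {α | CantorBendixson.iteratedDerivedSet (Set.univ : Set X) α =
    CantorBendixson.iteratedDerivedSet (Set.univ : Set X) (α + 1)}

/-- The Cantor–Bendixson rank is a genuine minimum. -/
theorem cantorBendixsonRank_isLeast (X : Type u) [TopologicalSpace X] :
    IsLeast {α | CantorBendixson.iteratedDerivedSet (Set.univ : Set X) α =
      CantorBendixson.iteratedDerivedSet (Set.univ : Set X) (α + 1)} (cantorBendixsonRank X) := by
  obtain ⟨a, ha⟩ := CantorBendixson.iteratedDerivedSet_mem_fixedPoints (Set.univ : Set X)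
  refine ⟨csInf_mem ⟨a, ?_⟩, fun α hα => csInf_le' hα⟩
  rw [Set.mem_ofPred_eq, CantorBendixson.iteratedDerivedSet_succ]
  exact (Function.mem_fixedPoints_iff.mp ha).symm

section Domain

variable (D : Type u) [CommRing D]

/-- The inverse topology on the spectrum, generated by the sets `V(I)` with `I` a finitely
generated ideal. -/
@[reducible] def inverseTopology : TopologicalSpace (PrimeSpectrum D) :=
  TopologicalSpace.generateFrom
    {U | ∃ I : Ideal D, I.FG ∧ U = PrimeSpectrum.zeroLocus (I : Set D)}

/-- The set of maximal ideals of `D`, to be endowed with the inverse topology. -/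
def MaxInv : Type u := MaximalSpectrum D

instance : TopologicalSpace (MaxInv D) :=
  (inverseTopology D).induced (MaximalSpectrum.toPrimeSpectrum (R := D))

variable (K : Type u) [IsDomain D] [Field K] [Algebra D K] [IsFractionRing D K]

/-- The localization `D_M`, as a subring of the field of fractions `K` of `D`. -/
noncomputable def localizationAt (M : MaximalSpectrum D) : Subring K :=
  (Localization.subalgebra.ofField K M.asIdeal.primeCompl
    M.asIdeal.primeCompl_le_nonZeroDivisors).toSubring

/-- The family of all localizations of `D` at its maximal ideals. -/
def maxLocalizations : Set (Subring K) :=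
  Set.range (localizationAt D K)

end Domain

end JaffardDegree

/-! For a set `X` of maximal ideals let `T_X` be the intersection of the `D_M`, `M ∈ X`. If `X` is
closed in the inverse topology and `M ∈ X`, then `D_M` is a Jaffard overring of `T_X` exactly when
`M` is isolated in `X`. By induction `Θ_α` is the image of the `α`-th derived set `X_α`, and `T_α =
T_{X_α}`. A closed `X` is recovered from `T_X`, since `T_X ≤ D_M` only for `M ∈ X`; so the `T_α` and
the `X_α` stabilize at the same ordinal.

If `M` is isolated, a finitely generated ideal separates it from the closed set `X \ {M}`. In
dimension one this yields, for each nonzero `y`, an `e` with `e / y ∈ D_M` and `(1 - e) / y ∈ T_{X \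
{M}}`. These elements `e` act as approximate idempotents, making the pair `D_M`, `T_{X \ {M}}` a
Jaffard family.

Conversely, in a Jaffard family containing `D_M`, independence makes `M` blow up in every other
member, and local finiteness lets one finitely generated ideal inside `M` do so in all of them. By
completeness no other point of `X` contains that ideal. -/

namespace JaffardDegree

/-! ### Two-element Jaffard families from splittings -/

section Pair

variable {K : Type u} [Field K]

/-- Clearing denominators in an element of `I A` moves it into `I`. -/
theorem exists_finset_of_mem_extend {A C : Subring K} {I : Ideal C} {x : K}
    (hx : x ∈ extend I A) :
    ∃ s : Finset K, (∀ d ∈ s, d ∈ A) ∧ ∀ c : K, (∀ d ∈ s, c * d ∈ C) →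
      c * x ∈ (fun a : C => (a : K)) '' (I : Set C) := by
  classical
  unfold extend at hx
  induction hx using Submodule.span_induction with
  | mem x hx =>
    obtain ⟨i, hi, rfl⟩ := hx
    refine ⟨{1}, by simp [A.one_mem], fun c hc => ?_⟩
    have hc : c ∈ C := by simpa using hc
    exact ⟨⟨c, hc⟩ * i, I.mul_mem_left _ hi, rfl⟩
  | zero => exact ⟨∅, by simp, fun c _ => ⟨0, I.zero_mem, by simp⟩⟩
  | add x y _ _ hx hy =>
    obtain ⟨s, hs, hs'⟩ := hx
    obtain ⟨t, ht, ht'⟩ := hy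
    refine ⟨s ∪ t, fun d hd => (Finset.mem_union.mp hd).elim (hs d) (ht d), fun c hc => ?_⟩
    obtain ⟨i, hi, hi'⟩ := hs' c fun d hd => hc d (Finset.mem_union_left _ hd)
    obtain ⟨j, hj, hj'⟩ := ht' c fun d hd => hc d (Finset.mem_union_right _ hd)
    exact ⟨i + j, I.add_mem hi hj, by simp [mul_add, ← hi', ← hj']⟩
  | smul a x _ hx =>
    obtain ⟨s, hs, hs'⟩ := hx
    refine ⟨s.image (fun d => (a : K) * d), ?_, fun c hc => ?_⟩
    · simpa using fun d hd => A.mul_mem a.2 (hs d hd)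
    · have := hs' (c * a) fun d hd => by
        rw [mul_assoc]; exact hc _ (Finset.mem_image_of_mem _ hd)
      rwa [mul_assoc] at this

/-- Splitting data exhibiting `C = A ∩ B` as a product decomposition away from `0`: every finite
subset of `K` has a common denominator `y` in `C` for which there is `e` in `C` divisible by `y`
in `A` and congruent to `1` modulo `y` in `B`. -/
structure IsSplitting (A B C : Subring K) : Prop where
  inf_eq : A ⊓ B = C
  exists_split : ∀ s : Finset K, ∃ y ∈ C, y ≠ 0 ∧ (∀ x ∈ s, y * x ∈ C) ∧
    ∃ e ∈ C, e / y ∈ A ∧ (1 - e) / y ∈ B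

namespace IsSplitting

variable {A B C : Subring K}

theorem symm (h : IsSplitting A B C) : IsSplitting B A C where
  inf_eq := inf_comm A B ▸ h.inf_eq
  exists_split s := by
    obtain ⟨y, hy, hy0, hs, e, he, hA, hB⟩ := h.exists_split s
    exact ⟨y, hy, hy0, hs, 1 - e, C.sub_mem C.one_mem he, hB, by simpa using hA⟩

theorem le_left (h : IsSplitting A B C) : C ≤ A := h.inf_eq ▸ inf_le_left

theorem le_right (h : IsSplitting A B C) : C ≤ B := h.inf_eq ▸ inf_le_right

theorem mem (h : IsSplitting A B C) {x : K} (hA : x ∈ A) (hB : x ∈ B) : x ∈ C :=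
  h.inf_eq ▸ Subring.mem_inf.mpr ⟨hA, hB⟩

/-- Multiplication by `e` carries elements of `B` with denominator `y` into `C`. -/
theorem mul_mem_of_div_mem (h : IsSplitting A B C) {e y d : K} (hy : y ≠ 0) (he : e ∈ C)
    (hA : e / y ∈ A) (hd : d ∈ B) (hyd : y * d ∈ C) : e * d ∈ C := by
  refine h.mem ?_ (B.mul_mem (h.le_right he) hd)
  have := A.mul_mem hA (h.le_left hyd)
  rwa [← mul_assoc, div_mul_cancel₀ _ hy] at this

/-- Equational criterion: any `x` in `A` with `y * x ∈ C` decomposes as `(1 - e) * x + (e / y) * (y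
* x)`, with `(1 - e) * x` and `y * x` in `C`. -/
theorem flat_left (h : IsSplitting A B C) : (Subring.inclusion h.le_left).Flat := by
  classical
  let _ := (Subring.inclusion h.le_left).toAlgebra
  refine Module.Flat.of_forall_isTrivialRelation fun {l f x} hfx => ?_
  have hsum : ∑ i, (f i : K) * (x i : K) = 0 := by
    have := congrArg (fun a : A => (a : K)) hfx
    simpa [Algebra.smul_def, RingHom.algebraMap_toAlgebra] using this
  obtain ⟨y, hy, hy0, hs, e, he, hA, hB⟩ :=
    h.exists_split (Finset.univ.image fun i => (x i : K))
  have hyx : ∀ i, y * (x i : K) ∈ C := fun i =>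
    hs _ (Finset.mem_image_of_mem _ (Finset.mem_univ i))
  have hex : ∀ i, (1 - e) * (x i : K) ∈ C := fun i =>
    h.symm.mul_mem_of_div_mem hy0 (C.sub_mem C.one_mem he) hB (x i).2 (hyx i)
  refine ⟨2, fun i => ![⟨_, hex i⟩, ⟨_, hyx i⟩], ![1, ⟨_, hA⟩], fun i => ?_, fun j => ?_⟩
  · apply Subtype.ext
    simp only [Fin.sum_univ_two, Algebra.smul_def, RingHom.algebraMap_toAlgebra]
    simp
    field_simp
    ring
  · apply Subtype.ext
    have hc : ∀ c : K, ∑ i, (f i : K) * (c * (x i : K)) = 0 := fun c => by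
      simp_rw [mul_left_comm _ c]
      rw [← Finset.mul_sum, hsum, mul_zero]
    fin_cases j
    · simpa using hc (1 - e)
    · simpa using hc y

/-- For a nonzero `p` in a common contraction, split with `y` a denominator of `p⁻¹`: then `e = (e /
y) * (y / p) * p` is in the prime through `A`, and `1 - e` is in it through `B`. -/
theorem sigma_inter_sigma (h : IsSplitting A B C) :
    sigma h.le_left ∩ sigma h.le_right = {⊥} := by
  refine Set.Subset.antisymm ?_ ?_
  · rintro P ⟨⟨Q, hQ⟩, ⟨R, hR⟩⟩
    by_contra hP
    have hP : P.asIdeal ≠ ⊥ := fun h => hP (PrimeSpectrum.ext h)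
    obtain ⟨p, hp, hp0⟩ := Submodule.exists_mem_ne_zero_of_ne_bot hP
    have hp0' : (p : K) ≠ 0 := fun h => hp0 (Subtype.ext h)
    obtain ⟨y, hy, hy0, hs, e, he, hA, hB⟩ := h.exists_split {(p : K)⁻¹}
    have hc : y * (p : K)⁻¹ ∈ C := hs _ (by simp)
    have hpQ : Subring.inclusion h.le_left p ∈ Q.asIdeal := by
      rw [← hQ] at hp; exact hp
    have hpR : Subring.inclusion h.le_right p ∈ R.asIdeal := by
      rw [← hR] at hp; exact hp
    have he1 : (⟨e, he⟩ : C) ∈ P.asIdeal := by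
      rw [← hQ]
      change Subring.inclusion h.le_left ⟨e, he⟩ ∈ Q.asIdeal
      have := Q.asIdeal.mul_mem_left (⟨_, hA⟩ * ⟨_, h.le_left hc⟩) hpQ
      convert this using 1
      apply Subtype.ext
      simp
      field_simp
    have he2 : (⟨1 - e, C.sub_mem C.one_mem he⟩ : C) ∈ P.asIdeal := by
      rw [← hR]
      change Subring.inclusion h.le_right ⟨1 - e, C.sub_mem C.one_mem he⟩ ∈ R.asIdeal
      have := R.asIdeal.mul_mem_left (⟨_, hB⟩ * ⟨_, h.le_right hc⟩) hpR
      convert this using 1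
      apply Subtype.ext
      simp
      field_simp
    refine P.2.ne_top ((Ideal.eq_top_iff_one _).mpr ?_)
    convert P.asIdeal.add_mem he1 he2 using 1
    apply Subtype.ext
    simp
  · rintro _ rfl
    constructor
    · refine ⟨⊥, PrimeSpectrum.ext ?_⟩
      exact (RingHom.injective_iff_ker_eq_bot _).mp (Subring.inclusion_injective h.le_left)
    · refine ⟨⊥, PrimeSpectrum.ext ?_⟩
      exact (RingHom.injective_iff_ker_eq_bot _).mp (Subring.inclusion_injective h.le_right)

/-- Write `x = (1 - e) * x + e * x`: multiplication by `1 - e` clears the denominators of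
coefficients in `A`, and by `e` those in `B`. -/
theorem image_eq_inter_extend (h : IsSplitting A B C) (I : Ideal C) :
    (fun a : C => (a : K)) '' (I : Set C) = (extend I A : Set K) ∩ (extend I B : Set K) := by
  classical
  refine Set.Subset.antisymm (fun x hx => ⟨Submodule.subset_span hx, Submodule.subset_span hx⟩) ?_
  rintro x ⟨hxA, hxB⟩
  obtain ⟨s, hs, hs'⟩ := exists_finset_of_mem_extend hxA
  obtain ⟨t, ht, ht'⟩ := exists_finset_of_mem_extend hxB
  obtain ⟨y, hy, hy0, hst, e, he, hA, hB⟩ := h.exists_split (s ∪ t)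
  obtain ⟨i, hi, hi'⟩ := hs' (1 - e) fun d hd =>
    h.symm.mul_mem_of_div_mem hy0 (C.sub_mem C.one_mem he) hB (hs d hd)
      (hst d (Finset.mem_union_left _ hd))
  obtain ⟨j, hj, hj'⟩ := ht' e fun d hd =>
    h.mul_mem_of_div_mem hy0 he hA (ht d hd) (hst d (Finset.mem_union_right _ hd))
  refine ⟨i + j, I.add_mem hi hj, ?_⟩
  simp only at hi' hj'
  simp only [Subring.coe_add, hi', hj']
  ring

theorem isJaffardFamily (h : IsSplitting A B C) (hA : A ≠ ⊤) (hB : B ≠ ⊤) :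
    IsJaffardFamily C {A, B} where
  overring := by
    rintro T (rfl | rfl)
    exacts [h.le_left, h.le_right]
  top_mem := Or.inl (by rintro (h | h); exacts [hA h.symm, hB h.symm])
  flat := by
    rintro T (rfl | rfl)
    exacts [h.flat_left, h.symm.flat_left]
  complete I := by
    rw [h.image_eq_inter_extend]
    simp
  independent := by
    rintro S (rfl | rfl) T (rfl | rfl) hST
    · exact absurd rfl hST
    · exact h.sigma_inter_sigma
    · exact h.symm.sigma_inter_sigma
    · exact absurd rfl hST
  locallyFinite x _ := (Set.toFinite {A, B}).subset fun _ h => h.1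

end IsSplitting

/-- Needed when `X = {M}`, where `T_X = D_M` and there is no complementary ring. -/
theorem isJaffardFamily_singleton_self (A : Subring K) : IsJaffardFamily A {A} where
  overring := by rintro T rfl; exact le_rfl
  top_mem := by
    by_cases h : A = ⊤
    · exact Or.inr (by rw [h])
    · exact Or.inl (fun h' => h h'.symm)
  flat := by
    rintro T rfl
    exact RingHom.Flat.id _
  complete I := by
    simp only [Set.mem_singleton_iff, Set.iInter_iInter_eq_left]
    refine Set.Subset.antisymm (fun x hx => Submodule.subset_span hx) fun x hx => ?_
    obtain ⟨s, hs, hs'⟩ := exists_finset_of_mem_extend (SetLike.mem_coe.mp hx)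
    simpa using hs' 1 (by simpa using hs)
  independent := by
    rintro S rfl T rfl h
    exact absurd rfl h
  locallyFinite x _ := (Set.finite_singleton A).subset fun _ h => h.1

end Pair

/-! ### Neighbourhoods and isolated points in the inverse topology -/

section Topology

variable {D : Type u} [CommRing D]

theorem isTopologicalBasis_inverseTopology :
    @TopologicalSpace.IsTopologicalBasis _ (inverseTopology D)
      {U | ∃ I : Ideal D, I.FG ∧ U = PrimeSpectrum.zeroLocus (I : Set D)} := by
  let _ := inverseTopology D
  exact {
    exists_subset_inter := by
      rintro _ ⟨I, hI, rfl⟩ _ ⟨J, hJ, rfl⟩ P hP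
      refine ⟨_, ⟨I ⊔ J, Submodule.FG.sup hI hJ, rfl⟩, ?_, ?_⟩ <;> rw [PrimeSpectrum.zeroLocus_sup]
      exact hP
    sUnion_eq := Set.sUnion_eq_univ_iff.mpr fun P =>
      ⟨_, ⟨⊥, Submodule.fg_bot, rfl⟩, by simp⟩
    eq_generateFrom := rfl }

/-- The sets of maximal ideals containing a given finitely generated ideal form a neighbourhood
basis in the inverse topology. -/
theorem MaxInv.mem_nhds_iff {M : MaxInv D} {U : Set (MaxInv D)} :
    U ∈ nhds M ↔ ∃ I : Ideal D, I.FG ∧ I ≤ MaximalSpectrum.asIdeal M ∧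
      ∀ N : MaxInv D, I ≤ MaximalSpectrum.asIdeal N → N ∈ U := by
  let _ := inverseTopology D
  have hb := (isTopologicalBasis_inverseTopology (D := D)).induced
    (MaximalSpectrum.toPrimeSpectrum (R := D))
  refine (hb.mem_nhds_iff (a := M)).trans ⟨?_, ?_⟩
  · rintro ⟨_, ⟨_, ⟨I, hI, rfl⟩, rfl⟩, hM, hU⟩
    exact ⟨I, hI, hM, fun N hN => hU hN⟩
  · rintro ⟨I, hI, hM, hU⟩
    exact ⟨_, ⟨_, ⟨I, hI, rfl⟩, rfl⟩, hM, fun N hN => hU N hN⟩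

theorem MaxInv.exists_fg_of_notMem {X : Set (MaxInv D)} (hX : IsClosed X) {M : MaxInv D}
    (hM : M ∉ X) : ∃ I : Ideal D, I.FG ∧ I ≤ MaximalSpectrum.asIdeal M ∧
      ∀ N ∈ X, ¬ I ≤ MaximalSpectrum.asIdeal N := by
  obtain ⟨I, hI, hIM, h⟩ := MaxInv.mem_nhds_iff.mp (hX.isOpen_compl.mem_nhds hM)
  exact ⟨I, hI, hIM, fun N hN hIN => h N hIN hN⟩

theorem MaxInv.notMem_derivedSet_iff {X : Set (MaxInv D)} {M : MaxInv D} :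
    M ∉ derivedSet X ↔ ∃ I : Ideal D, I.FG ∧ I ≤ MaximalSpectrum.asIdeal M ∧
      ∀ N ∈ X, I ≤ MaximalSpectrum.asIdeal N → N = M := by
  rw [mem_derivedSet, accPt_iff_nhds]
  push Not
  constructor
  · rintro ⟨U, hU, h⟩
    obtain ⟨I, hI, hIM, h'⟩ := MaxInv.mem_nhds_iff.mp hU
    exact ⟨I, hI, hIM, fun N hN hIN => h N ⟨h' N hIN, hN⟩⟩
  · rintro ⟨I, hI, hIM, h⟩
    exact ⟨{N | I ≤ MaximalSpectrum.asIdeal N},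
      MaxInv.mem_nhds_iff.mpr ⟨I, hI, hIM, fun _ h => h⟩, fun N hN => h N hN.2 hN.1⟩

end Topology

/-! ### Localizations inside `K` and their intersections -/

section Localization

theorem algebraMap_ne_zero_of_notMem {D : Type u} [CommRing D] {K : Type u} [Field K]
    [Algebra D K] [IsFractionRing D K] {M : MaximalSpectrum D} {s : D} (hs : s ∉ M.asIdeal) :
    algebraMap D K s ≠ 0 := by
  rw [Ne, IsFractionRing.to_map_eq_zero_iff]
  rintro rfl
  exact hs M.asIdeal.zero_mem

variable {D : Type u} [CommRing D] [IsDomain D] {K : Type u} [Field K] [Algebra D K]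
  [IsFractionRing D K]

theorem mem_localizationAt {M : MaximalSpectrum D} {x : K} :
    x ∈ localizationAt D K M ↔
      ∃ a s : D, s ∉ M.asIdeal ∧ x = algebraMap D K a / algebraMap D K s := by
  simp only [div_eq_mul_inv]
  constructor
  · rintro ⟨a, s, hs, h⟩
    exact ⟨a, s, hs, h⟩
  · rintro ⟨a, s, hs, h⟩
    exact ⟨a, s, hs, h⟩

theorem algebraMap_mem_localizationAt (M : MaximalSpectrum D) (a : D) :
    algebraMap D K a ∈ localizationAt D K M :=
  mem_localizationAt.mpr ⟨a, 1, (Ideal.ne_top_iff_one _).mp M.2.ne_top, by simp⟩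

theorem div_mem_localizationAt {M : MaximalSpectrum D} {s e y c : D} (hs : s ∉ M.asIdeal)
    (hy : y ≠ 0) (h : s * e = y * c) :
    algebraMap D K e / algebraMap D K y ∈ localizationAt D K M := by
  refine mem_localizationAt.mpr ⟨c, s, hs, ?_⟩
  have hs' : algebraMap D K s ≠ 0 := algebraMap_ne_zero_of_notMem hs
  have hy' : algebraMap D K y ≠ 0 := by rwa [Ne, IsFractionRing.to_map_eq_zero_iff]
  rw [div_eq_div_iff hy' hs', ← map_mul, ← map_mul, mul_comm e, mul_comm c, h]

theorem mem_of_div_mem_localizationAt {M : MaximalSpectrum D} {e y : D} (hy : y ≠ 0)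
    (hyM : y ∈ M.asIdeal)
    (h : algebraMap D K e / algebraMap D K y ∈ localizationAt D K M) : e ∈ M.asIdeal := by
  obtain ⟨a, s, hs, h⟩ := mem_localizationAt.mp h
  have hs' : algebraMap D K s ≠ 0 := algebraMap_ne_zero_of_notMem hs
  have hy' : algebraMap D K y ≠ 0 := by rwa [Ne, IsFractionRing.to_map_eq_zero_iff]
  rw [div_eq_div_iff hy' hs', ← map_mul, ← map_mul] at h
  have h := IsFractionRing.injective D K h
  exact (M.2.isPrime.mem_or_mem (h ▸ M.asIdeal.mul_mem_left a hyM)).resolve_right hs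

theorem inv_mem_localizationAt {M : MaximalSpectrum D} {s : D} (hs : s ∉ M.asIdeal) :
    (algebraMap D K s)⁻¹ ∈ localizationAt D K M :=
  mem_localizationAt.mpr ⟨1, s, hs, by simp⟩

theorem inv_notMem_localizationAt {M : MaximalSpectrum D} {s : D} (hs0 : s ≠ 0)
    (hs : s ∈ M.asIdeal) : (algebraMap D K s)⁻¹ ∉ localizationAt D K M := fun h =>
  (Ideal.ne_top_iff_one _).mp M.2.ne_top
    (mem_of_div_mem_localizationAt (K := K) (e := 1) hs0 hs (by simpa using h))

theorem localizationAt_injective : Function.Injective (localizationAt D K) := by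
  intro M N h
  by_contra hMN
  have hle : ¬ M.asIdeal ≤ N.asIdeal := fun hle =>
    hMN (MaximalSpectrum.ext (M.2.eq_of_le N.2.ne_top hle))
  obtain ⟨a, haM, haN⟩ := SetLike.not_le_iff_exists.mp hle
  have ha0 : a ≠ 0 := fun h0 => haN (h0 ▸ N.asIdeal.zero_mem)
  exact inv_notMem_localizationAt ha0 haM (h ▸ inv_mem_localizationAt (K := K) haN)

theorem localizationAt_ne_top {M : MaximalSpectrum D} (hM : M.asIdeal ≠ ⊥) :
    localizationAt D K M ≠ ⊤ := by
  obtain ⟨a, ha, ha0⟩ := Submodule.exists_mem_ne_zero_of_ne_bot hM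
  intro h
  exact inv_notMem_localizationAt (K := K) ha0 ha (h ▸ Subring.mem_top _)

theorem isUnit_localizationAt_iff {M : MaximalSpectrum D} {a s : D} (hs : s ∉ M.asIdeal)
    {x : localizationAt D K M} (hx : (x : K) = algebraMap D K a / algebraMap D K s) :
    IsUnit x ↔ a ∉ M.asIdeal := by
  have hs' : algebraMap D K s ≠ 0 := algebraMap_ne_zero_of_notMem hs
  constructor
  · rintro ⟨u, rfl⟩ ha
    have h1 : ((u : localizationAt D K M) : K) * ((u⁻¹ : (localizationAt D K M)ˣ) :
        localizationAt D K M) = 1 := by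
      rw [← Subring.coe_mul, Units.mul_inv, Subring.coe_one]
    have ha0 : a ≠ 0 := by
      rintro rfl
      simp [hx] at h1
    refine hs (mem_of_div_mem_localizationAt (K := K) ha0 ha ?_)
    convert ((u⁻¹ : (localizationAt D K M)ˣ) : localizationAt D K M).2 using 1
    rw [eq_inv_of_mul_eq_one_right h1, hx, inv_div]
  · intro ha
    have ha' : algebraMap D K a ≠ 0 := algebraMap_ne_zero_of_notMem ha
    refine IsUnit.of_mul_eq_one
      ⟨algebraMap D K s / algebraMap D K a, mem_localizationAt.mpr ⟨s, a, ha, rfl⟩⟩ ?_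
    apply Subtype.ext
    simp [hx]
    field_simp

theorem isLocalRing_localizationAt (M : MaximalSpectrum D) :
    IsLocalRing (localizationAt D K M) :=
  IsLocalization.AtPrime.isLocalRing
    (Localization.subalgebra.ofField K M.asIdeal.primeCompl
      M.asIdeal.primeCompl_le_nonZeroDivisors) M.asIdeal

variable (D K) in
/-- The intersection of the localizations of `D` at the maximal ideals in `X`. -/
noncomputable def interLocalizations (X : Set (MaxInv D)) : Subring K :=
  sInf ((fun M : MaxInv D => localizationAt D K M) '' X)

theorem mem_interLocalizations {X : Set (MaxInv D)} {x : K} :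
    x ∈ interLocalizations D K X ↔ ∀ N ∈ X, x ∈ localizationAt D K N := by
  rw [interLocalizations, Subring.mem_sInf]
  exact Set.forall_mem_image

theorem algebraMap_mem_interLocalizations (X : Set (MaxInv D)) (a : D) :
    algebraMap D K a ∈ interLocalizations D K X :=
  mem_interLocalizations.mpr fun N _ => algebraMap_mem_localizationAt N a

theorem interLocalizations_le {X : Set (MaxInv D)} {M : MaxInv D} (hM : M ∈ X) :
    interLocalizations D K X ≤ localizationAt D K M :=
  sInf_le ⟨M, hM, rfl⟩

/-- Reconciles the convention `T_0 = D` with the intersection formula used for `α > 0`. -/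
theorem interLocalizations_univ :
    interLocalizations D K Set.univ = (algebraMap D K).range := by
  ext x
  rw [mem_interLocalizations, RingHom.mem_range, ← Set.mem_range, ← Algebra.mem_bot,
    ← MaximalSpectrum.iInf_localization_eq_bot D K, Algebra.mem_iInf]
  exact ⟨fun h v => h v trivial, fun h v _ => h v⟩

end Localization

/-! ### Dimension one: isolated points give Jaffard overrings -/

section DimensionOne

variable {D : Type u} [CommRing D] [IsDomain D] [Ring.KrullDimLE 1 D]

/-- Modulo a nonzero `y`, a power of `a` is killed by some `1 - a b`. -/
theorem exists_dvd_pow_mul_one_sub {y : D} (hy : y ≠ 0) (a : D) :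
    ∃ (n : ℕ) (b : D), y ∣ a ^ n * (1 - a * b) := by
  let S : Submonoid D :=
    { carrier := {x | ∃ (n : ℕ) (b : D), x = a ^ n * (1 - a * b)}
      one_mem' := ⟨0, 0, by simp⟩
      mul_mem' := by
        rintro _ _ ⟨n, b, rfl⟩ ⟨m, c, rfl⟩
        exact ⟨n + m, b + c - a * b * c, by ring⟩ }
  by_contra! h
  have hd : Disjoint (Ideal.span {y} : Set D) S := by
    rw [Set.disjoint_left]
    rintro x hx ⟨n, b, rfl⟩
    exact h n b (Ideal.mem_span_singleton.mp hx)
  -- A prime over `y` is nonzero, hence maximal. It misses `a ∈ S`, so `a` is invertible modulo it,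
  -- which puts some `1 - a * b` in both `P` and `S`.
  obtain ⟨P, hP, hle, hdis⟩ := Ideal.exists_le_prime_disjoint _ S hd
  have hyP : y ∈ P := hle (Ideal.mem_span_singleton_self y)
  have hmax : P.IsMaximal := hP.isMaximal_of_ne_bot fun h0 => hy (by simpa [h0] using hyP)
  have haP : a ∉ P := fun ha => Set.disjoint_left.mp hdis ha ⟨1, 0, by simp⟩
  obtain ⟨b, hb⟩ := hmax.exists_inv haP
  obtain ⟨i, hi, hbi⟩ := hb
  refine Set.disjoint_left.mp hdis hi ⟨0, b, ?_⟩
  rw [← hbi]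
  ring

variable {K : Type u} [Field K] [Algebra D K] [IsFractionRing D K]

theorem exists_div_mem_of_notMem_of_isClosed {X : Set (MaxInv D)} (hX : IsClosed X)
    {M : MaxInv D} (hM : M ∉ X) {y : D} (hy : y ≠ 0) :
    ∃ e : D, algebraMap D K e / algebraMap D K y ∈ localizationAt D K M ∧
      algebraMap D K (1 - e) / algebraMap D K y ∈ interLocalizations D K X := by
  obtain ⟨_, ⟨s, rfl⟩, hsM, hsX⟩ := MaxInv.exists_fg_of_notMem hX hM
  choose n b hnb using exists_dvd_pow_mul_one_sub hy
  have hM1 : ∀ a ∈ MaximalSpectrum.asIdeal M, ∀ c, 1 - a * c ∉ MaximalSpectrum.asIdeal M :=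
    fun a ha c h => (Ideal.ne_top_iff_one _).mp M.2.ne_top
      (by simpa using Ideal.add_mem _ h (Ideal.mul_mem_right c _ ha))
  -- `t` is `1` modulo `M`, and `y` divides `t` in every `D_N` with `N ∈ X`, because some generator
  -- `a` is a unit there.
  let t : D := ∏ a ∈ s, (1 - a * b a)
  have htM : 1 - t ∈ MaximalSpectrum.asIdeal M := by
    rw [← Ideal.Quotient.eq_zero_iff_mem, map_sub, map_prod, sub_eq_zero, map_one, eq_comm]
    refine Finset.prod_eq_one fun a ha => ?_
    have : a ∈ MaximalSpectrum.asIdeal M := hsM (Ideal.subset_span ha)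
    rw [map_sub, map_mul, Ideal.Quotient.eq_zero_iff_mem.mpr this]
    simp
  -- As `1 - t ∈ M`, the cofactor `1 - (1 - t) * b (1 - t)` is a unit at `M`, so `y` divides this
  -- power in `D_M`; and `t` divides `1` minus it.
  refine ⟨(1 - t) ^ n (1 - t), ?_, mem_interLocalizations.mpr fun N hN => ?_⟩
  · obtain ⟨c, hc⟩ := hnb (1 - t)
    exact div_mem_localizationAt (hM1 _ htM (b (1 - t))) hy (by rw [mul_comm, hc])
  · have : ∃ a ∈ s, a ∉ MaximalSpectrum.asIdeal N := by
      by_contra! h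
      exact hsX N hN (Ideal.span_le.mpr h)
    obtain ⟨a, ha, haN⟩ := this
    obtain ⟨c, hc⟩ := hnb a
    obtain ⟨d, hd⟩ : 1 - a * b a ∣ t := Finset.dvd_prod_of_mem _ ha
    obtain ⟨r, hr⟩ : t ∣ 1 - (1 - t) ^ n (1 - t) := by
      simpa using sub_dvd_pow_sub_pow 1 (1 - t) (n (1 - t))
    refine div_mem_localizationAt (s := a ^ n a) (c := c * d * r)
      (fun h => haN (N.2.isPrime.mem_of_pow_mem _ h)) hy ?_
    rw [hr, hd]
    linear_combination d * r * hc

/-- A closed set of maximal ideals is determined by the intersection of the localizations. -/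
theorem interLocalizations_le_localizationAt_iff (hmax : ∀ M : MaximalSpectrum D, M.asIdeal ≠ ⊥)
    {X : Set (MaxInv D)} (hX : IsClosed X) {M : MaxInv D} :
    interLocalizations D K X ≤ localizationAt D K M ↔ M ∈ X := by
  refine ⟨fun h => ?_, interLocalizations_le⟩
  by_contra hM
  obtain ⟨y, hyM, hy⟩ := Submodule.exists_mem_ne_zero_of_ne_bot (hmax M)
  -- With `y ∈ M`, both `e` and `1 - e` would lie in `M`.
  obtain ⟨e, he, he'⟩ := exists_div_mem_of_notMem_of_isClosed (K := K) hX hM hy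
  have h1 := mem_of_div_mem_localizationAt hy hyM he
  have h2 := mem_of_div_mem_localizationAt hy hyM (h he')
  exact (Ideal.ne_top_iff_one _).mp M.2.ne_top (by simpa using Ideal.add_mem _ h1 h2)

theorem isJaffardOverring_of_notMem_derivedSet (hmax : ∀ M : MaximalSpectrum D, M.asIdeal ≠ ⊥)
    {X : Set (MaxInv D)} (hX : IsClosed X) {M : MaxInv D} (hM : M ∈ X) (hMX : M ∉ derivedSet X) :
    IsJaffardOverring (interLocalizations D K X) (localizationAt D K M) := by
  classical
  obtain ⟨I, hI, hIM, hIX⟩ := MaxInv.notMem_derivedSet_iff.mp hMX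
  by_cases hXM : X = {M}
  · have : interLocalizations D K X = localizationAt D K M := by
      ext x
      rw [mem_interLocalizations, hXM]
      simp
    rw [this]
    exact ⟨_, isJaffardFamily_singleton_self _, rfl⟩
  have hX' : IsClosed (X \ {M}) := by
    rw [← isOpen_compl_iff, isOpen_iff_mem_nhds]
    intro N hN
    by_cases hNM : N = M
    · subst hNM
      exact MaxInv.mem_nhds_iff.mpr ⟨I, hI, hIM, fun N hN hNX => hNX.2 (hIX N hNX.1 hN)⟩
    · exact Filter.mem_of_superset (hX.isOpen_compl.mem_nhds fun h => hN ⟨h, hNM⟩)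
        fun P hP hP' => hP hP'.1
  -- A second point keeps the complementary ring different from `K`.
  obtain ⟨N, hNX, hNM⟩ : ∃ N ∈ X, N ≠ M := by
    by_contra! h
    exact hXM (Set.eq_singleton_iff_unique_mem.mpr ⟨hM, h⟩)
  have hsplit : IsSplitting (localizationAt D K M) (interLocalizations D K (X \ {M}))
      (interLocalizations D K X) :=
    { inf_eq := by
        ext x
        simp only [Subring.mem_inf, mem_interLocalizations]
        refine ⟨fun h N hN => ?_, fun h => ⟨h M hM, fun N hN => h N hN.1⟩⟩
        by_cases hNM : N = M
        · exact hNM ▸ h.1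
        · exact h.2 N ⟨hN, hNM⟩
      exists_split := fun s => by
        obtain ⟨y, hy⟩ := IsLocalization.exist_integer_multiples_of_finset (nonZeroDivisors D) s
        have hy0 : (y : D) ≠ 0 := nonZeroDivisors.ne_zero y.2
        obtain ⟨e, he, he'⟩ := exists_div_mem_of_notMem_of_isClosed (K := K) hX'
          (fun h : M ∈ X \ {M} => h.2 rfl) hy0
        refine ⟨algebraMap D K y, algebraMap_mem_interLocalizations X _, ?_, fun x hx => ?_,
          algebraMap D K e, algebraMap_mem_interLocalizations X _, he, by simpa using he'⟩
        · rwa [Ne, IsFractionRing.to_map_eq_zero_iff]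
        · obtain ⟨a, ha⟩ := hy x hx
          rw [← Algebra.smul_def]
          exact ha ▸ algebraMap_mem_interLocalizations X a }
  refine ⟨_, hsplit.isJaffardFamily (localizationAt_ne_top (hmax M)) fun h => ?_, Or.inl rfl⟩
  exact localizationAt_ne_top (K := K) (hmax N)
    (top_le_iff.mp (h ▸ interLocalizations_le ⟨hNX, hNM⟩))

end DimensionOne

/-! ### Jaffard overrings come from isolated points -/

section Isolated

variable {D : Type u} [CommRing D] [IsDomain D] {K : Type u} [Field K] [Algebra D K]
  [IsFractionRing D K]

/-- The inclusion of `D` in an intersection of localizations. -/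
noncomputable def toInterLocalizations (X : Set (MaxInv D)) : D →+* interLocalizations D K X :=
  (algebraMap D K).codRestrict _ (algebraMap_mem_interLocalizations X)

/-- A prime of the intersection lying over `M ∈ X` is the contraction of a prime of `D_M`. -/
theorem mem_sigma_localizationAt {X : Set (MaxInv D)} {M : MaxInv D} (hM : M ∈ X)
    (P : PrimeSpectrum (interLocalizations D K X))
    (hP : P.asIdeal.comap (toInterLocalizations X) = MaximalSpectrum.asIdeal M) :
    P ∈ sigma (interLocalizations_le (K := K) hM) := by
  have hloc := isLocalRing_localizationAt (K := K) M
  have hPM : ∀ a : D, toInterLocalizations X a ∈ P.asIdeal ↔ a ∈ MaximalSpectrum.asIdeal M :=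
    fun a => by rw [← hP, Ideal.mem_comap]
  refine ⟨IsLocalRing.closedPoint _, PrimeSpectrum.ext (Ideal.ext fun t => ?_)⟩
  change Subring.inclusion _ t ∈ IsLocalRing.maximalIdeal _ ↔ _
  obtain ⟨a, s, hs, h⟩ := mem_localizationAt.mp (interLocalizations_le hM t.2)
  rw [IsLocalRing.mem_maximalIdeal, mem_nonunits_iff, isUnit_localizationAt_iff hs h, not_not,
    ← hPM a]
  have hs' : algebraMap D K s ≠ 0 := algebraMap_ne_zero_of_notMem hs
  have hst : toInterLocalizations X a = toInterLocalizations X s * t := by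
    apply Subtype.ext
    change algebraMap D K a = algebraMap D K s * t
    rw [h, mul_div_cancel₀ _ hs']
  rw [hst]
  exact ⟨fun h => (P.2.mem_or_mem h).resolve_left fun h => hs ((hPM s).mp h),
    fun h => P.asIdeal.mul_mem_left _ h⟩

/-- The other members of a Jaffard family containing `D_M` blow up `M`. -/
theorem exists_fg_one_mem_span {X : Set (MaxInv D)} {M : MaxInv D} (hM : M ∈ X)
    (hM0 : MaximalSpectrum.asIdeal M ≠ ⊥) {Λ : Set (Subring K)}
    (hΛ : IsJaffardFamily (interLocalizations D K X) Λ) (hMΛ : localizationAt D K M ∈ Λ)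
    {S : Subring K} (hS : S ∈ Λ) (hSM : S ≠ localizationAt D K M) :
    ∃ I : Ideal D, I.FG ∧ I ≤ MaximalSpectrum.asIdeal M ∧
      (1 : K) ∈ Submodule.span S (algebraMap D K '' (I : Set D)) := by
  classical
  suffices h : (1 : K) ∈ Submodule.span S
      (algebraMap D K '' (MaximalSpectrum.asIdeal M : Set D)) by
    obtain ⟨t, ht, h1⟩ := Submodule.mem_span_finite_of_mem_span h
    obtain ⟨s, hs, rfl⟩ := Finset.subset_set_image_iff.mp ht
    refine ⟨Ideal.span s, ⟨s, rfl⟩, Ideal.span_le.mpr hs, Submodule.span_mono ?_ h1⟩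
    rw [Finset.coe_image]
    exact Set.image_mono Ideal.subset_span
  have hTS := hΛ.overring S hS
  let f : D →+* S := (Subring.inclusion hTS).comp (toInterLocalizations X)
  by_cases htop : (MaximalSpectrum.asIdeal M).map f = ⊤
  · have h1 : (1 : S) ∈ Submodule.span S (f '' (MaximalSpectrum.asIdeal M : Set D)) :=
      (Ideal.eq_top_iff_one _).mp htop
    have := Submodule.mem_map_of_mem (f := Algebra.linearMap S K) h1
    rw [Submodule.map_span, ← Set.image_comp] at this
    exact this
  · exfalso
    -- The contraction of `Q` to `T_X` lies over `M`, so it also comes from `D_M`; independence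
    -- makes it zero, contradicting `M ≠ 0`.
    obtain ⟨Q, hQ, hle⟩ := Ideal.exists_le_maximal _ htop
    let q : PrimeSpectrum S := ⟨Q, hQ.isPrime⟩
    let P := PrimeSpectrum.comap (Subring.inclusion hTS) q
    have hle' : MaximalSpectrum.asIdeal M ≤ P.asIdeal.comap (toInterLocalizations X) :=
      fun a ha => hle (Ideal.mem_map_of_mem f ha)
    have hP : P.asIdeal.comap (toInterLocalizations X) = MaximalSpectrum.asIdeal M :=
      (M.2.eq_of_le (Ideal.IsPrime.comap _ (hK := P.2)).ne_top hle').symm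
    have hmem : P ∈ sigma (hΛ.overring _ hS) ∩ sigma (hΛ.overring _ hMΛ) :=
      ⟨⟨q, rfl⟩, mem_sigma_localizationAt hM P hP⟩
    rw [hΛ.independent _ hS _ hMΛ hSM, Set.mem_singleton_iff] at hmem
    refine hM0 (le_bot_iff.mp fun a ha => ?_)
    rw [← hP, hmem] at ha
    have : algebraMap D K a = 0 := congrArg Subtype.val (show toInterLocalizations X a = 0 from ha)
    simpa using this

/-- A fixed nonzero `m ∈ M` is a unit in all but finitely many members. Adding to `(m)` an ideal for
each exception gives a finitely generated `J ≤ M` that isolates `M`. -/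
theorem notMem_derivedSet_of_isJaffardOverring {X : Set (MaxInv D)} {M : MaxInv D} (hM : M ∈ X)
    (hM0 : MaximalSpectrum.asIdeal M ≠ ⊥)
    (h : IsJaffardOverring (interLocalizations D K X) (localizationAt D K M)) :
    M ∉ derivedSet X := by
  classical
  obtain ⟨Λ, hΛ, hMΛ⟩ := h
  obtain ⟨m, hm, hm0⟩ := Submodule.exists_mem_ne_zero_of_ne_bot hM0
  have hmK : algebraMap D K m ≠ 0 := by rwa [Ne, IsFractionRing.to_map_eq_zero_iff]
  have hI : ∀ S : Subring K, ∃ I : Ideal D, I.FG ∧ I ≤ MaximalSpectrum.asIdeal M ∧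
      (S ∈ Λ → S ≠ localizationAt D K M →
        (1 : K) ∈ Submodule.span S (algebraMap D K '' (I : Set D))) := by
    intro S
    by_cases hS : S ∈ Λ ∧ S ≠ localizationAt D K M
    · obtain ⟨I, hI, hIM, h1⟩ := exists_fg_one_mem_span hM hM0 hΛ hMΛ hS.1 hS.2
      exact ⟨I, hI, hIM, fun _ _ => h1⟩
    · exact ⟨⊥, Submodule.fg_bot, bot_le, fun h1 h2 => absurd ⟨h1, h2⟩ hS⟩
  choose I hIfg hIM hI1 using hI
  let F := (hΛ.locallyFinite _ hmK).toFinset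
  let J : Ideal D := Ideal.span {m} ⊔ F.sup I
  have hspan : ∀ S ∈ Λ, S ≠ localizationAt D K M →
      (1 : K) ∈ Submodule.span S (algebraMap D K '' (J : Set D)) := by
    intro S hS hSM
    have hmS : algebraMap D K m ∈ S :=
      hΛ.overring S hS (algebraMap_mem_interLocalizations X m)
    by_cases hu : IsUnit (⟨_, hmS⟩ : S)
    · obtain ⟨v, hv⟩ := hu.exists_left_inv
      have hmJ : algebraMap D K m ∈ algebraMap D K '' (J : Set D) :=
        ⟨m, (le_sup_left : _ ≤ J) (Ideal.mem_span_singleton_self m), rfl⟩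
      have := Submodule.smul_mem _ v (Submodule.subset_span (R := S) hmJ)
      convert this using 1
      exact (congrArg Subtype.val hv).symm
    · have hSF : S ∈ F := by simpa [F] using ⟨hS, hmS, hu⟩
      have hle : I S ≤ J := (Finset.le_sup hSF).trans le_sup_right
      exact Submodule.span_mono (Set.image_mono hle) (hI1 S hS hSM)
  refine MaxInv.notMem_derivedSet_iff.mpr ⟨J, ?_, ?_, fun N hN hJN => ?_⟩
  · exact Submodule.FG.sup (Submodule.fg_span_singleton m)
      (Submodule.fg_finset_sup _ _ fun S _ => hIfg S)
  · exact sup_le ((Ideal.span_singleton_le_iff_mem _).mpr hm) (Finset.sup_le fun S _ => hIM S)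
  have hloc := isLocalRing_localizationAt (K := K) N
  let P : Ideal (interLocalizations D K X) :=
    (IsLocalRing.maximalIdeal (localizationAt D K N)).comap
      (Subring.inclusion (interLocalizations_le hN))
  have hNP : ∀ a ∈ MaximalSpectrum.asIdeal N, toInterLocalizations X a ∈ P := fun a ha => by
    rw [Ideal.mem_comap, IsLocalRing.mem_maximalIdeal, mem_nonunits_iff,
      isUnit_localizationAt_iff (a := a) (s := 1) ((Ideal.ne_top_iff_one _).mp N.2.ne_top), not_not]
    · exact ha
    · simp only [map_one, div_one]
      rfl
  have h1 : (1 : K) ∉ (fun a : interLocalizations D K X => (a : K)) '' (P : Set _) := by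
    rintro ⟨p, hp, hp1⟩
    have hp1 : p = 1 := Subtype.ext hp1
    exact (Ideal.ne_top_iff_one _).mp
      (Ideal.IsPrime.comap _ (hK := (IsLocalRing.maximalIdeal.isMaximal _).isPrime)).ne_top
      (hp1 ▸ hp)
  -- Completeness gives a member `S` with `P S ≠ S`. As `J ≤ N`, only `S = D_M` is possible, and
  -- then every element of `N` must lie in `M`.
  rw [hΛ.complete P] at h1
  simp only [Set.mem_iInter, not_forall] at h1
  obtain ⟨S, hS, hSP⟩ := h1
  have himage : ∀ a ∈ MaximalSpectrum.asIdeal N, algebraMap D K a ∈ extend P S := fun a ha =>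
    Submodule.subset_span ⟨_, hNP a ha, rfl⟩
  have hSM : S = localizationAt D K M := by
    by_contra hSM
    refine hSP (Submodule.span_le.mpr ?_ (hspan S hS hSM))
    rintro _ ⟨a, ha, rfl⟩
    exact himage a (hJN ha)
  subst hSM
  refine MaximalSpectrum.ext (N.2.eq_of_le M.2.ne_top fun a ha => ?_)
  by_contra haM
  refine hSP (SetLike.mem_coe.mpr ?_)
  have := Submodule.smul_mem _ (⟨_, inv_mem_localizationAt haM⟩ : localizationAt D K M)
    (himage a ha)
  convert this using 1
  exact (inv_mul_cancel₀ (algebraMap_ne_zero_of_notMem (K := K) haM)).symm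

end Isolated

/-! ### Matching the two transfinite sequences -/

section Main

open CantorBendixson

variable {D : Type u} [CommRing D] [IsDomain D] {K : Type u} [Field K] [Algebra D K]
  [IsFractionRing D K]

theorem derivedRing_eq_interLocalizations_of_derivedFamily_eq {α : Ordinal.{u}}
    (h : derivedFamily (algebraMap D K).range (maxLocalizations D K) α =
      (fun M : MaxInv D => localizationAt D K M) '' iteratedDerivedSet (Set.univ : Set (MaxInv D)) α) :
    derivedRing (algebraMap D K).range (maxLocalizations D K) α =
      interLocalizations D K (iteratedDerivedSet Set.univ α) := by
  by_cases hα : α = 0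
  · rw [hα, derivedRing_zero, iteratedDerivedSet_zero, interLocalizations_univ]
  · rw [derivedRing_eq_sInf _ _ hα, h, interLocalizations]

variable [Ring.KrullDimLE 1 D]

theorem eq_of_interLocalizations_eq (hmax : ∀ M : MaximalSpectrum D, M.asIdeal ≠ ⊥)
    {X Y : Set (MaxInv D)} (hX : IsClosed X) (hY : IsClosed Y)
    (h : interLocalizations D K X = interLocalizations D K Y) : X = Y := by
  ext M
  rw [← interLocalizations_le_localizationAt_iff (K := K) hmax hX, h,
    interLocalizations_le_localizationAt_iff hmax hY]

theorem derivedFamily_maxLocalizations (hmax : ∀ M : MaximalSpectrum D, M.asIdeal ≠ ⊥)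
    (α : Ordinal.{u}) :
    derivedFamily (algebraMap D K).range (maxLocalizations D K) α =
      (fun M : MaxInv D => localizationAt D K M) '' iteratedDerivedSet (Set.univ : Set (MaxInv D)) α := by
  induction α using Ordinal.limitRecOn with
  | zero =>
    rw [derivedFamily_zero, iteratedDerivedSet_zero]
    exact Set.image_univ.symm
  | add_one α ih =>
    have hcl := isClosed_iteratedDerivedSet (isClosed_univ (X := MaxInv D)) α
    rw [derivedFamily_add_one, derivedRing_eq_interLocalizations_of_derivedFamily_eq ih, ih,
      iteratedDerivedSet_succ, relDerivedSet_apply]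
    ext T
    constructor
    · rintro ⟨⟨M, hM, rfl⟩, hT⟩
      refine ⟨M, ⟨?_, hM⟩, rfl⟩
      by_contra hMX
      exact hT (isJaffardOverring_of_notMem_derivedSet hmax hcl hM hMX)
    · rintro ⟨M, ⟨hMX, hM⟩, rfl⟩
      exact ⟨⟨M, hM, rfl⟩, fun hT => notMem_derivedSet_of_isJaffardOverring hM (hmax M) hT hMX⟩
  | limit α hα ih =>
    rw [derivedFamily_limit _ _ hα, iteratedDerivedSet_limit hα]
    ext T
    simp only [Set.mem_iInter]
    constructor
    · intro h
      -- Stage `0` fixes `M`; injectivity of `M ↦ D_M` identifies it with the witness at each later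
      -- stage.
      obtain ⟨M, -, rfl⟩ := ih 0 hα.bot_lt ▸ h 0 hα.bot_lt
      refine ⟨M, Set.mem_iInter.mpr fun β => ?_, rfl⟩
      obtain ⟨N, hN, hNM⟩ := ih β β.2 ▸ h β β.2
      exact localizationAt_injective hNM ▸ hN
    · rintro ⟨M, hM, rfl⟩ β hβ
      rw [ih β hβ]
      exact ⟨M, Set.mem_iInter.mp hM ⟨β, hβ⟩, rfl⟩

theorem derivedRing_maxLocalizations_eq_iff (hmax : ∀ M : MaximalSpectrum D, M.asIdeal ≠ ⊥)
    (α β : Ordinal.{u}) :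
    derivedRing (algebraMap D K).range (maxLocalizations D K) α =
        derivedRing (algebraMap D K).range (maxLocalizations D K) β ↔
      iteratedDerivedSet (Set.univ : Set (MaxInv D)) α = iteratedDerivedSet Set.univ β := by
  rw [derivedRing_eq_interLocalizations_of_derivedFamily_eq (derivedFamily_maxLocalizations hmax α),
    derivedRing_eq_interLocalizations_of_derivedFamily_eq (derivedFamily_maxLocalizations hmax β)]
  exact ⟨eq_of_interLocalizations_eq hmax (isClosed_iteratedDerivedSet isClosed_univ α)
    (isClosed_iteratedDerivedSet isClosed_univ β), fun h => by rw [h]⟩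

/-- Bridges the two stopping rules: a set fixed by one derivation is fixed by all later ones. -/
theorem iteratedDerivedSet_eq_add_one_iff {X : Type u} [TopologicalSpace X] {s : Set X}
    {α : Ordinal.{u}} : iteratedDerivedSet s α = iteratedDerivedSet s (α + 1) ↔
      ∀ β > α, iteratedDerivedSet s α = iteratedDerivedSet s β := by
  refine ⟨fun h β hβ => ?_, fun h => h _ (lt_add_one α)⟩
  exact (OrdinalApprox.gfpApprox_eq_of_mem_fixedPoints relDerivedSet (le_of_lt hβ)
    (mem_fixedPoints_of_iteratedDerivedSet_succ_eq h.symm)).symm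

end Main

end JaffardDegree

theorem mainTheorem4 (D : Type u) [CommRing D] [IsDomain D] (K : Type u) [Field K] [Algebra D K]
    [IsFractionRing D K] (hdim : ringKrullDim D = 1) :
    JaffardDegree.jaffardDegree (algebraMap D K).range (JaffardDegree.maxLocalizations D K) =
      JaffardDegree.cantorBendixsonRank (JaffardDegree.MaxInv D) := by
  have hle : Ring.KrullDimLE 1 D := Ring.krullDimLE_iff.mpr hdim.le
  have hmax : ∀ M : MaximalSpectrum D, M.asIdeal ≠ ⊥ := fun M => by
    refine Ring.ne_bot_of_isMaximal_of_not_isField M.2 fun hD => ?_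
    rw [ringKrullDim_eq_zero_of_isField hD] at hdim
    exact zero_ne_one hdim
  unfold JaffardDegree.jaffardDegree JaffardDegree.cantorBendixsonRank
  simp_rw [JaffardDegree.derivedRing_maxLocalizations_eq_iff hmax,
    JaffardDegree.iteratedDerivedSet_eq_add_one_iff]
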